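/- Let $G:\mathbb R\to\mathbb R$ have the spectral density $\widehat G$, that is, $G(x)=\int_{\mathbb R}\widehat G(t)e^{itx}\,dt$ with $\widehat G$ integrable, and suppose that $\widehat G(t)=e^{-S(|t|)}=e^{-T(\ln|t|)}$ for all real $t\neq 0$, where $S\in C^2((0,\infty))$ and $T\in C^2(\mathbb R)$ are real-valued, $S'(t)\ge 0$ and $S''(t)\ge 0$ for all $t>0$, and $S'(t)\to+\infty$ as $t\to+\infty$. For pairwise distinct points $x_1,\dots,x_K\in[-1,1]$ the matrix $\mathbf G_K=(G(x_k-x_l))_{k,l=1}^K$ is positive definite; for $x\in[-1,1]$ put $$\sigma^2_{x;\{x_k\}_{k=1}^K}=G(0)-\mathbf g^t\,\mathbf G_K^{-1}\,\mathbf g,\qquad \mathbf g=(G(x-x_1),\dots,G(x-x_K))^t ;$$ this is the conditional variance of $\xi_x$ given $\xi_{x_1},\dots,\xi_{x_K}$ for every centered Gaussian process $(\xi_y)_{y\in[-1,1]}$ with covariance $\mathsf E(\xi_y\xi_z)=G(y-z)$. Let $T^*(q)=\max_{s\in\mathbb R}(qs-T(s))$ be the Legendre transform of $T$ (the maximum exists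 for all sufficiently large $q$), and let $$F(K)=T^*(2K+1)-(2K+1)\ln K .$$ Then there is a $K_0$ such that for all integers $K\ge K_0$ and any $K+1$ distinct points $x,x_1,\dots,x_K\in[-1,1]$ $$e^{-K}\;\le\;\frac{\sigma^2_{x;\{x_k\}_{k=1}^K}}{e^{F(K)}\prod_{k=1}^K|x-x_k|^2}\;\le\; e^{2K}.$$ Furthermore, $F(K)$ is strictly decreasing in the integer $K$ for all sufficiently large $K$, and $F(K)/K\to-\infty$ as $K\to+\infty$. -/

import Mathlib

open MeasureTheory ProbabilityTheory Filter Topology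

noncomputable section

/-- `Ghat` is the spectral density of the (translation invariant) covariance function `G`:
`G x = ∫ Ghat t * exp (i t x) dt`. -/
structure IsSpectralDensity (Ghat G : ℝ → ℝ) : Prop where
  integrable : Integrable Ghat
  eq_integral : ∀ x : ℝ,
    (G x : ℂ) = ∫ t : ℝ, (Ghat t : ℂ) * Complex.exp (Complex.I * (t : ℂ) * (x : ℂ))

/-- The translation invariant kernel `G (x', x'') = G (x' - x'')` on `[-1, 1]`. -/
def stationaryKernel (G : ℝ → ℝ) (x y : Set.Icc (-1 : ℝ) 1) : ℝ := G ((x : ℝ) - (y : ℝ))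

/-- The Gram matrix `(k (x_i, x_j))` of a kernel at finitely many points. -/
def kernelMatrix {D : Type*} (k : D → D → ℝ) {K : ℕ} (p : Fin K → D) :
    Matrix (Fin K) (Fin K) ℝ := Matrix.of fun i j => k (p i) (p j)

/-- The vector `(k (x, x_i))`. -/
def kernelVector {D : Type*} (k : D → D → ℝ) {K : ℕ} (x : D) (p : Fin K → D) : Fin K → ℝ :=
  fun i => k x (p i)

/-- The conditional variance at `x`, given the values at `p 0, …, p (K - 1)`, of a centered
Gaussian process with covariance `k`: it is `k (x, x) - gᵗ M⁻¹ g`, where `M` is the Gram matrix at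
the points `p` and `g` is the vector of the covariances of `x` with these points. -/
def gaussianCondVariance {D : Type*} (k : D → D → ℝ) {K : ℕ} (x : D) (p : Fin K → D) : ℝ :=
  k x x - kernelVector k x p ⬝ᵥ ((kernelMatrix k p)⁻¹.mulVec (kernelVector k x p))

/-- `ξ` is a centered Gaussian process with covariance kernel `k`. -/
structure IsCenteredGaussian {D Ω : Type*} [MeasurableSpace Ω] (P : Measure Ω)
    (ξ : D → Ω → ℝ) (k : D → D → ℝ) : Prop where
  measurable : ∀ x, Measurable (ξ x)
  gaussian : IsGaussianProcess ξ P
  centered : ∀ x, P[ξ x] = 0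
  covariance : ∀ x y, P[fun ω => ξ x ω * ξ y ω] = k x y

/-- The Legendre transform `T* (q) = max_s (q s - T s)`. -/
def legendreTransform (T : ℝ → ℝ) (q : ℝ) : ℝ := sSup (Set.range fun s : ℝ => q * s - T s)

/-- `F (K) = T* (2 K + 1) - (2 K + 1) ln K`. -/
def rateF (T : ℝ → ℝ) (K : ℝ) : ℝ :=
  legendreTransform T (2 * K + 1) - (2 * K + 1) * Real.log K

end

/-!
The conditional variance is the squared distance, in `L²` of the spectral density, of
`t ↦ exp (i t x)` from the span of the `t ↦ exp (i t x_k)`: it is the minimum over `c` of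
`residualEnergy`, attained at `c = M⁻¹ g` (`gaussianCondVariance_le`, `gaussianCondVariance_eq`).
Both bounds are obtained by elementary estimates of this distance. Throughout, `q = 2 K + 1`, and
`u` is the solution of `u S'(u) = q`, so that `T* q = q log u - S u`. Since `S' → ∞`, `u = o(K)`.

*Upper bound.* Interpolating `y ↦ exp (i t y)` at the nodes gives coefficients with
`|exp (i t x) - ∑ c_k exp (i t x_k)| ≤ |t| ^ K / K! * ∏ |x - x_k|` (`exists_norm_cexp_sub_le`), so
the variance is at most `∏ |x - x_k| ^ 2 / K! ^ 2` times a moment of the density. As `S` lies above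
its tangent at `u`, that moment is at most a Gamma integral, and the constants then match exactly
through `(2 K choose K) ≤ 4 ^ K` and `(1 - 1 / q) ^ q ≤ 1 / e`.

*Lower bound.* The operator taking `f` to
`t ↦ (exp (-i a x_k) f (t + a) - exp (i a x_k) f (t - a)) / (2 i)` annihilates `exp (i t x_k)`,
multiplies `exp (i t x)` by `sin (a (x - x_k))`, and does not increase `L²` norms once the interval
is enlarged by `a` on both sides. Applying it for every node bounds the `L²` norm of any residual
on `[-(K + 1) a, (K + 1) a]` from below by `√(2 a) ∏ |sin (a (x - x_k))|`
(`prod_sin_sq_le_integral`). On this interval the density is at least `exp (-S ((K + 1) a))`; the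
choice `(K + 1) a = u` gives the peak of `t ^ q exp (-S t)`, and `a → 0` makes the sines linear.
The same inequality shows that the Gram matrix is positive definite.

The statements on `F` follow from `u = o(K)`: `F (K + 1) - F K ≤ 2 log (u / (K + 1))`, where `u`
belongs to `2 K + 3`, and `F K ≤ q log (u / K) + C`.

For a Gaussian process, the residual `ξ_x - ∑ c_k ξ_{x_k}` with `c = M⁻¹ g` is uncorrelated with,
hence independent of, the observations, so the conditional variance is its second moment.
-/

/-! ### Gram forms as spectral integrals -/

theorem IsSpectralDensity.integrable_mul_cexp {Ghat G : ℝ → ℝ} (hG : IsSpectralDensity Ghat G)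
    (x : ℝ) :
    Integrable fun t : ℝ => (Ghat t : ℂ) * Complex.exp (Complex.I * (t : ℂ) * (x : ℂ)) := by
  refine (hG.integrable.ofReal (𝕜 := ℂ)).mul_bdd (c := 1) ?_ ?_
  · exact (by fun_prop : Continuous fun t : ℝ =>
      Complex.exp (Complex.I * (t : ℂ) * (x : ℂ))).aestronglyMeasurable
  · refine .of_forall fun t => ?_
    have : Complex.I * (t : ℂ) * (x : ℂ) = ((t * x : ℝ) : ℂ) * Complex.I := by push_cast; ring
    rw [this, Complex.norm_exp_ofReal_mul_I]

theorem conj_cexp_I_mul (t x : ℝ) :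
    (starRingEnd ℂ) (Complex.exp (Complex.I * (t : ℂ) * (x : ℂ)))
      = Complex.exp (Complex.I * (t : ℂ) * ((-x : ℝ) : ℂ)) := by
  rw [← Complex.exp_conj]
  simp

/-- `G` is even because both `G` and its spectral density are real-valued. -/
theorem IsSpectralDensity.even {Ghat G : ℝ → ℝ} (hG : IsSpectralDensity Ghat G) (x : ℝ) :
    G (-x) = G x := by
  apply Complex.ofReal_injective
  rw [hG.eq_integral, ← Complex.conj_ofReal (G x), hG.eq_integral x, ← integral_conj]
  refine integral_congr_ae (.of_forall fun t => ?_)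
  simp only [map_mul, Complex.conj_ofReal, conj_cexp_I_mul]

theorem sq_norm_sum_cexp {ι : Type*} [Fintype ι] (y v : ι → ℝ) (t : ℝ) :
    ((‖∑ i, (v i : ℂ) * Complex.exp (Complex.I * (t : ℂ) * (y i : ℂ))‖ ^ 2 : ℝ) : ℂ)
      = ∑ i, ∑ j, ((v i * v j : ℝ) : ℂ) *
          Complex.exp (Complex.I * (t : ℂ) * ((y i - y j : ℝ) : ℂ)) := by
  rw [← Complex.normSq_eq_norm_sq, ← Complex.mul_conj, map_sum, Finset.sum_mul_sum]
  refine Finset.sum_congr rfl fun i _ => Finset.sum_congr rfl fun j _ => ?_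
  rw [map_mul, Complex.conj_ofReal, conj_cexp_I_mul]
  have : Complex.I * (t : ℂ) * ((y i - y j : ℝ) : ℂ)
      = Complex.I * (t : ℂ) * (y i : ℂ) + Complex.I * (t : ℂ) * ((-y j : ℝ) : ℂ) := by
    push_cast; ring
  rw [this, Complex.exp_add]
  push_cast; ring

/-- The Gram quadratic form of a stationary kernel is the squared norm of an exponential sum in
`L²` of the spectral density. -/
theorem IsSpectralDensity.integrable_and_sum_eq_integral {Ghat G : ℝ → ℝ}
    (hG : IsSpectralDensity Ghat G)
    {ι : Type*} [Fintype ι] (y v : ι → ℝ) :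
    (Integrable fun t : ℝ => Ghat t *
      ‖∑ i, (v i : ℂ) * Complex.exp (Complex.I * (t : ℂ) * (y i : ℂ))‖ ^ 2) ∧
    ∑ i, ∑ j, v i * v j * G (y i - y j) = ∫ t : ℝ, Ghat t *
      ‖∑ i, (v i : ℂ) * Complex.exp (Complex.I * (t : ℂ) * (y i : ℂ))‖ ^ 2 := by
  have key : ∀ t : ℝ, ((Ghat t *
      ‖∑ i, (v i : ℂ) * Complex.exp (Complex.I * (t : ℂ) * (y i : ℂ))‖ ^ 2 : ℝ) : ℂ)
      = ∑ i, ∑ j, ((v i * v j : ℝ) : ℂ) *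
        ((Ghat t : ℂ) * Complex.exp (Complex.I * (t : ℂ) * ((y i - y j : ℝ) : ℂ))) := by
    intro t
    rw [Complex.ofReal_mul, sq_norm_sum_cexp, Finset.mul_sum]
    refine Finset.sum_congr rfl fun i _ => ?_
    rw [Finset.mul_sum]
    exact Finset.sum_congr rfl fun j _ => by ring
  have hij : ∀ i j, Integrable fun t : ℝ => ((v i * v j : ℝ) : ℂ) *
        ((Ghat t : ℂ) * Complex.exp (Complex.I * (t : ℂ) * ((y i - y j : ℝ) : ℂ))) :=
    fun i j => (hG.integrable_mul_cexp _).const_mul _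
  constructor
  · have h := (integrable_finsetSum Finset.univ fun i _ =>
      integrable_finsetSum Finset.univ fun j _ => hij i j).re
    refine h.congr (.of_forall fun t => ?_)
    simp only
    rw [← key t]
    exact Complex.ofReal_re _
  · apply Complex.ofReal_injective
    rw [← integral_complex_ofReal]
    simp_rw [key]
    rw [integral_finsetSum _ fun i _ => integrable_finsetSum _ fun j _ => hij i j]
    simp_rw [integral_finsetSum _ fun j _ => hij _ j, integral_const_mul, ← hG.eq_integral]
    push_cast
    rfl

/-- The Gram form at the points `x, p 0, …` with the coefficients `1, -c 0, …`. -/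
theorem sum_sum_fin_cons {K : ℕ} (G : ℝ → ℝ) (hG : ∀ x, G (-x) = G x) (x : ℝ) (p c : Fin K → ℝ) :
    ∑ i : Fin (K + 1), ∑ j : Fin (K + 1), (Fin.cons 1 (-c) : Fin (K + 1) → ℝ) i *
      (Fin.cons 1 (-c) : Fin (K + 1) → ℝ) j *
        G ((Fin.cons x p : Fin (K + 1) → ℝ) i - (Fin.cons x p : Fin (K + 1) → ℝ) j)
      = G 0 - 2 * ∑ i, c i * G (x - p i) + ∑ i, ∑ j, c i * c j * G (p i - p j) := by
  simp only [Fin.sum_univ_succ, Fin.cons_zero, Fin.cons_succ, Pi.neg_apply, sub_self]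
  have h : ∀ i, G (p i - x) = G (x - p i) := fun i => by rw [← hG, neg_sub]
  simp only [h, Finset.sum_add_distrib, mul_one, one_mul, neg_mul, mul_neg, neg_neg,
    Finset.sum_neg_distrib]
  ring

/-- Completing the square: `c = M⁻¹ g` minimizes the quadratic polynomial on the right, and
`dotProduct_inv_eq` gives the value of the minimum. -/
theorem dotProduct_sub_inv_le {K : ℕ} {M : Matrix (Fin K) (Fin K) ℝ} (hM : M.PosDef)
    (g c : Fin K → ℝ) :
    -(g ⬝ᵥ M⁻¹.mulVec g) ≤ -2 * (c ⬝ᵥ g) + c ⬝ᵥ M.mulVec c := by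
  have hdet : IsUnit M.det := (Matrix.isUnit_iff_isUnit_det _).1 hM.isUnit
  have hMd : M.mulVec (M⁻¹.mulVec g) = g := by
    rw [Matrix.mulVec_mulVec, Matrix.mul_nonsing_inv _ hdet, Matrix.one_mulVec]
  set d := M⁻¹.mulVec g with hd
  have hsymm : d ⬝ᵥ M.mulVec c = c ⬝ᵥ g := by
    have hT : M.transpose = M := by
      have := hM.isHermitian.eq
      rwa [Matrix.conjTranspose_eq_transpose_of_trivial] at this
    rw [Matrix.dotProduct_mulVec, ← Matrix.mulVec_transpose, hT, hMd, dotProduct_comm]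
  have h0 := hM.posSemidef.dotProduct_mulVec_nonneg (c - d)
  simp only [star_trivial, Matrix.mulVec_sub, hMd, sub_dotProduct, dotProduct_sub, hsymm] at h0
  rw [dotProduct_comm g d]
  linarith

theorem dotProduct_inv_eq {K : ℕ} {M : Matrix (Fin K) (Fin K) ℝ} (hM : M.PosDef)
    (g : Fin K → ℝ) :
    -(g ⬝ᵥ M⁻¹.mulVec g)
      = -2 * (M⁻¹.mulVec g ⬝ᵥ g) + M⁻¹.mulVec g ⬝ᵥ M.mulVec (M⁻¹.mulVec g) := by
  have hdet : IsUnit M.det := (Matrix.isUnit_iff_isUnit_det _).1 hM.isUnit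
  rw [Matrix.mulVec_mulVec, Matrix.mul_nonsing_inv _ hdet, Matrix.one_mulVec,
    dotProduct_comm g]
  ring

/-- The squared distance, in `L²` of the density `Ghat`, of `exp (i t x)` from the combination of
the `exp (i t (p k))` with coefficients `c k`. -/
noncomputable def residualEnergy (Ghat : ℝ → ℝ) {K : ℕ} (x : ℝ) (p c : Fin K → ℝ) : ℝ :=
  ∫ t : ℝ, Ghat t * ‖Complex.exp (Complex.I * (t : ℂ) * (x : ℂ))
    - ∑ k, (c k : ℂ) * Complex.exp (Complex.I * (t : ℂ) * (p k : ℂ))‖ ^ 2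

theorem sum_cons_cexp {K : ℕ} (x : ℝ) (p c : Fin K → ℝ) (t : ℝ) :
    ∑ i : Fin (K + 1), (((Fin.cons 1 (-c) : Fin (K + 1) → ℝ) i : ℝ) : ℂ) *
      Complex.exp (Complex.I * (t : ℂ) * (((Fin.cons x p : Fin (K + 1) → ℝ) i : ℝ) : ℂ))
    = Complex.exp (Complex.I * (t : ℂ) * (x : ℂ))
      - ∑ k, (c k : ℂ) * Complex.exp (Complex.I * (t : ℂ) * (p k : ℂ)) := by
  simp [Fin.sum_univ_succ, Finset.sum_neg_distrib, sub_eq_add_neg]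

theorem IsSpectralDensity.integrable_residual {Ghat G : ℝ → ℝ} (hG : IsSpectralDensity Ghat G)
    {K : ℕ} (x : ℝ) (p c : Fin K → ℝ) :
    Integrable fun t : ℝ => Ghat t * ‖Complex.exp (Complex.I * (t : ℂ) * (x : ℂ))
      - ∑ k, (c k : ℂ) * Complex.exp (Complex.I * (t : ℂ) * (p k : ℂ))‖ ^ 2 := by
  simpa only [sum_cons_cexp] using (hG.integrable_and_sum_eq_integral
    (Fin.cons x p : Fin (K + 1) → ℝ) (Fin.cons 1 (-c))).1

theorem IsSpectralDensity.residualEnergy_eq {Ghat G : ℝ → ℝ} (hG : IsSpectralDensity Ghat G)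
    {K : ℕ} (x : Set.Icc (-1 : ℝ) 1) (p : Fin K → Set.Icc (-1 : ℝ) 1) (c : Fin K → ℝ) :
    residualEnergy Ghat x (fun k => (p k : ℝ)) c
      = G 0 + (-2 * (c ⬝ᵥ kernelVector (stationaryKernel G) x p)
        + c ⬝ᵥ (kernelMatrix (stationaryKernel G) p).mulVec c) := by
  have h := (hG.integrable_and_sum_eq_integral
    (Fin.cons (x : ℝ) (fun k => (p k : ℝ)) : Fin (K + 1) → ℝ) (Fin.cons 1 (-c))).2
  rw [sum_sum_fin_cons G hG.even] at h
  simp only [sum_cons_cexp] at h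
  rw [residualEnergy, ← h]
  simp only [dotProduct, kernelVector, stationaryKernel, Matrix.mulVec, kernelMatrix,
    Matrix.of_apply, Finset.mul_sum]
  have : ∀ i j, c i * (G ((p i : ℝ) - p j) * c j) = c i * c j * G ((p i : ℝ) - p j) :=
    fun i j => by ring
  simp only [this, neg_mul, Finset.sum_neg_distrib]
  ring

theorem IsSpectralDensity.gaussianCondVariance_le {Ghat G : ℝ → ℝ}
    (hG : IsSpectralDensity Ghat G)
    {K : ℕ} (x : Set.Icc (-1 : ℝ) 1) (p : Fin K → Set.Icc (-1 : ℝ) 1)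
    (hM : (kernelMatrix (stationaryKernel G) p).PosDef) (c : Fin K → ℝ) :
    gaussianCondVariance (stationaryKernel G) x p
      ≤ residualEnergy Ghat x (fun k => (p k : ℝ)) c := by
  have h := dotProduct_sub_inv_le hM (kernelVector (stationaryKernel G) x p) c
  rw [hG.residualEnergy_eq, gaussianCondVariance, stationaryKernel, sub_self]
  linarith

theorem IsSpectralDensity.gaussianCondVariance_eq {Ghat G : ℝ → ℝ}
    (hG : IsSpectralDensity Ghat G)
    {K : ℕ} (x : Set.Icc (-1 : ℝ) 1) (p : Fin K → Set.Icc (-1 : ℝ) 1)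
    (hM : (kernelMatrix (stationaryKernel G) p).PosDef) :
    gaussianCondVariance (stationaryKernel G) x p
      = residualEnergy Ghat x (fun k => (p k : ℝ))
        ((kernelMatrix (stationaryKernel G) p)⁻¹.mulVec
          (kernelVector (stationaryKernel G) x p)) := by
  have h := dotProduct_inv_eq hM (kernelVector (stationaryKernel G) x p)
  rw [hG.residualEnergy_eq, gaussianCondVariance, stationaryKernel, sub_self]
  linarith

/-! ### Exponential sums: interpolation and separation -/

theorem norm_cexp_I_mul (t x : ℝ) : ‖Complex.exp (Complex.I * (t : ℂ) * (x : ℂ))‖ = 1 := by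
  have : Complex.I * (t : ℂ) * (x : ℂ) = ((t * x : ℝ) : ℂ) * Complex.I := by push_cast; ring
  rw [this, Complex.norm_exp_ofReal_mul_I]

/-- One integration step in the induction on the number of nodes. -/
theorem norm_le_pow_div_factorial {f f' : ℝ → ℂ} {n : ℕ} (h0 : f 0 = 0)
    (hd : ∀ t, HasDerivAt f (f' t) t) (hb : ∀ t, 0 ≤ t → ‖f' t‖ ≤ t ^ n / n.factorial)
    {t : ℝ} (ht : 0 ≤ t) : ‖f t‖ ≤ t ^ (n + 1) / (n + 1).factorial := by
  refine image_norm_le_of_norm_deriv_right_le_deriv_boundary (a := 0) (b := t) (f := f) (f' := f')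
    (B := fun s => s ^ (n + 1) / (n + 1).factorial) (B' := fun s => s ^ n / n.factorial)
    (fun s _ => (hd s).continuousAt.continuousWithinAt) (fun s _ => (hd s).hasDerivWithinAt)
    (by simp [h0]) (fun s => ?_) (fun s hs => hb s hs.1) ⟨ht, le_rfl⟩
  have h := (hasDerivAt_pow (n + 1) s).div_const ((n + 1).factorial : ℝ)
  refine h.congr_deriv ?_
  rw [Nat.factorial_succ]
  have : (n.factorial : ℝ) ≠ 0 := by positivity
  push_cast
  field_simp

theorem hasDerivAt_cexp_I_mul (t x : ℝ) :
    HasDerivAt (fun t : ℝ => Complex.exp (Complex.I * (t : ℂ) * (x : ℂ)))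
      (Complex.exp (Complex.I * (t : ℂ) * (x : ℂ)) * (Complex.I * x)) t := by
  have h : HasDerivAt (fun t : ℝ => Complex.I * (t : ℂ) * (x : ℂ)) (Complex.I * x) t := by
    simpa using ((Complex.ofRealCLM.hasDerivAt (x := t)).const_mul Complex.I).mul_const (x : ℂ)
  exact h.cexp

/-- The sum inside the norm is the divided difference of `z ↦ exp (i t z)` at `y` and the nodes, as
a function of `t`. Adding a node `x m` integrates it: after modulation by `exp (-i t (x m))` the new
divided difference vanishes at `t = 0` and has derivative of the modulus of the old one, whence the
factorial. -/
theorem exists_norm_dividedDifference_le {ι : Type*} [DecidableEq ι] (x : ι → ℝ) (y : ℝ)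
    (s : Finset ι) (hinj : Set.InjOn x s) (hy : ∀ k ∈ s, y ≠ x k) :
    ∃ c : ι → ℝ, ∀ t : ℝ,
      ‖((∏ k ∈ s, (y - x k))⁻¹ : ℝ) * Complex.exp (Complex.I * (t : ℂ) * (y : ℂ))
        - ∑ k ∈ s, (c k : ℂ) * Complex.exp (Complex.I * (t : ℂ) * (x k : ℂ))‖
      ≤ |t| ^ s.card / s.card.factorial := by
  induction s using Finset.induction_on with
  | empty => exact ⟨0, fun t => by simp [norm_cexp_I_mul]⟩
  | insert m s hm ih =>
    obtain ⟨c, hc⟩ := ih (hinj.mono (by simp)) fun k hk => hy k (by simp [hk])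
    set w : ℝ := (∏ k ∈ s, (y - x k))⁻¹ with hw
    have hym : (y - x m : ℂ) ≠ 0 := by
      exact_mod_cast sub_ne_zero.2 (hy m (by simp))
    have hxm : ∀ k ∈ s, (x k - x m : ℂ) ≠ 0 := by
      intro k hk
      have : x k ≠ x m := fun h => hm (hinj (by simp [hk]) (by simp) h ▸ hk)
      exact_mod_cast sub_ne_zero.2 this
    set A : ℝ := w / (y - x m) - ∑ k ∈ s, c k / (x k - x m) with hA
    let d : ι → ℝ := fun k => if k = m then A else c k / (x k - x m)
    refine ⟨d, ?_⟩
    -- the modulated sum `exp (-i t x_m) f t` has derivative of the modulus bounded inductively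
    let f : ℝ → ℂ := fun t => (w / (y - x m) : ℝ) *
        Complex.exp (Complex.I * (t : ℂ) * ((y - x m : ℝ) : ℂ))
        - (A + ∑ k ∈ s, ((c k / (x k - x m) : ℝ) : ℂ) *
          Complex.exp (Complex.I * (t : ℂ) * ((x k - x m : ℝ) : ℂ)))
    let f' : ℝ → ℂ := fun t => Complex.I * Complex.exp (Complex.I * (t : ℂ) * ((-x m : ℝ) : ℂ)) *
      ((w : ℝ) * Complex.exp (Complex.I * (t : ℂ) * (y : ℂ))
        - ∑ k ∈ s, (c k : ℂ) * Complex.exp (Complex.I * (t : ℂ) * (x k : ℂ)))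
    have hsplit : ∀ t z : ℝ, Complex.exp (Complex.I * (t : ℂ) * ((z - x m : ℝ) : ℂ))
        = Complex.exp (Complex.I * (t : ℂ) * ((-x m : ℝ) : ℂ)) *
          Complex.exp (Complex.I * (t : ℂ) * (z : ℂ)) := by
      intro t z
      rw [← Complex.exp_add]
      congr 1
      push_cast; ring
    have hf0 : f 0 = 0 := by
      simp [f, hA]
    have hd : ∀ t, HasDerivAt f (f' t) t := by
      intro t
      have h1 := (hasDerivAt_cexp_I_mul t (y - x m)).const_mul (((w / (y - x m) : ℝ)) : ℂ)
      have h2 := HasDerivAt.fun_sum (u := s) fun k _ =>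
        (hasDerivAt_cexp_I_mul t (x k - x m)).const_mul (((c k / (x k - x m) : ℝ)) : ℂ)
      refine (h1.sub (h2.const_add (A : ℂ))).congr_deriv ?_
      simp only [f', mul_sub, Finset.mul_sum]
      congr 1
      · rw [hsplit]
        push_cast
        field_simp
      · refine Finset.sum_congr rfl fun k hk => ?_
        have := hxm k hk
        rw [hsplit]
        push_cast
        field_simp
    have hb : ∀ t, ‖f' t‖ ≤ |t| ^ s.card / s.card.factorial := by
      intro t
      simp only [f', norm_mul, Complex.norm_I, norm_cexp_I_mul, one_mul]
      exact hc t
    have hcard : (insert m s).card = s.card + 1 := Finset.card_insert_of_notMem hm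
    have hpos : ∀ t, 0 ≤ t → ‖f t‖ ≤ t ^ (s.card + 1) / (s.card + 1).factorial := fun t ht =>
      norm_le_pow_div_factorial hf0 hd (fun u hu => by simpa [abs_of_nonneg hu] using hb u) ht
    -- negative `t` reduces to positive `t` because the coefficients are real
    have hconj : ∀ t, f (-t) = (starRingEnd ℂ) (f t) := by
      intro t
      have : ∀ z : ℝ, Complex.exp (Complex.I * ((-t : ℝ) : ℂ) * (z : ℂ))
          = (starRingEnd ℂ) (Complex.exp (Complex.I * (t : ℂ) * (z : ℂ))) := by
        intro z
        rw [conj_cexp_I_mul]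
        congr 1
        push_cast; ring
      simp only [f, this, map_sub, map_add, map_sum, map_mul, Complex.conj_ofReal]
    have hall : ∀ t, ‖f t‖ ≤ |t| ^ (s.card + 1) / (s.card + 1).factorial := by
      intro t
      rcases le_total 0 t with ht | ht
      · simpa [abs_of_nonneg ht] using hpos t ht
      · have h := hpos (-t) (by linarith)
        rwa [hconj, RCLike.norm_conj, ← abs_of_nonpos ht] at h
    intro t
    rw [hcard]
    refine le_trans (le_of_eq ?_) (hall t)
    have hmul : f t = Complex.exp (Complex.I * (t : ℂ) * ((-x m : ℝ) : ℂ)) *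
        (((∏ k ∈ insert m s, (y - x k))⁻¹ : ℝ) * Complex.exp (Complex.I * (t : ℂ) * (y : ℂ))
        - ∑ k ∈ insert m s, (d k : ℂ) * Complex.exp (Complex.I * (t : ℂ) * (x k : ℂ))) := by
      have hcancel : Complex.exp (Complex.I * (t : ℂ) * ((-x m : ℝ) : ℂ)) *
          Complex.exp (Complex.I * (t : ℂ) * (x m : ℂ)) = 1 := by
        rw [← hsplit]; simp
      have hsum : ∑ k ∈ s, (d k : ℂ) * Complex.exp (Complex.I * (t : ℂ) * (x k : ℂ))
          = ∑ k ∈ s, ((c k / (x k - x m) : ℝ) : ℂ) *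
            Complex.exp (Complex.I * (t : ℂ) * (x k : ℂ)) := by
        refine Finset.sum_congr rfl fun k hk => ?_
        have : k ≠ m := fun h => hm (h ▸ hk)
        simp [d, this]
      have hprod : (∏ k ∈ insert m s, (y - x k))⁻¹ = w / (y - x m) := by
        rw [Finset.prod_insert hm, mul_inv, hw]
        ring
      rw [Finset.sum_insert hm, hsum, hprod]
      simp only [f, hsplit t y, hsplit t (x _), d, if_true, mul_sub, mul_add, Finset.mul_sum]
      congr 1
      · ring
      · congr 1
        · rw [mul_left_comm, hcancel, mul_one]
        · exact Finset.sum_congr rfl fun k _ => by ring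
    rw [hmul, norm_mul, norm_cexp_I_mul, one_mul]

theorem exists_norm_cexp_sub_le {K : ℕ} (x : ℝ) (p : Fin K → ℝ)
    (hinj : Function.Injective p) (hx : ∀ k, x ≠ p k) :
    ∃ c : Fin K → ℝ, ∀ t : ℝ,
      ‖Complex.exp (Complex.I * (t : ℂ) * (x : ℂ))
        - ∑ k, (c k : ℂ) * Complex.exp (Complex.I * (t : ℂ) * (p k : ℂ))‖
      ≤ |t| ^ K / K.factorial * ∏ k, |x - p k| := by
  obtain ⟨c, hc⟩ := exists_norm_dividedDifference_le p x Finset.univ hinj.injOn fun k _ => hx k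
  set w := ∏ k, (x - p k) with hw
  have hw0 : w ≠ 0 := Finset.prod_ne_zero_iff.2 fun k _ => sub_ne_zero.2 (hx k)
  refine ⟨fun k => w * c k, fun t => ?_⟩
  have h := mul_le_mul_of_nonneg_left (hc t) (abs_nonneg w)
  have he : Complex.exp (Complex.I * (t : ℂ) * (x : ℂ))
        - ∑ k, ((w * c k : ℝ) : ℂ) * Complex.exp (Complex.I * (t : ℂ) * (p k : ℂ))
      = (w : ℂ) * ((w⁻¹ : ℝ) * Complex.exp (Complex.I * (t : ℂ) * (x : ℂ))
        - ∑ k, (c k : ℂ) * Complex.exp (Complex.I * (t : ℂ) * (p k : ℂ))) := by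
    rw [mul_sub, ← mul_assoc, ← Complex.ofReal_mul, mul_inv_cancel₀ hw0, Complex.ofReal_one,
      one_mul, Finset.mul_sum]
    congr 1
    exact Finset.sum_congr rfl fun k _ => by push_cast; ring
  rw [he, norm_mul, Complex.norm_real, Real.norm_eq_abs, mul_comm (_ / _), ← Finset.abs_prod]
  simpa using h

/-- A modulated symmetric difference of step `a` does not increase the `L²` norm, provided the
interval is enlarged by `a` on both sides. -/
theorem integral_sq_norm_modulated_difference_le {f : ℝ → ℂ} (hf : Continuous f) {u v : ℂ}
    (hu : ‖u‖ = 1) (hv : ‖v‖ = 1) {a b : ℝ} (ha : 0 ≤ a) (hb : 0 ≤ b) :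
    ∫ t in -b..b, ‖(u * f (t + a) - v * f (t - a)) / (2 * Complex.I)‖ ^ 2
      ≤ ∫ t in -(b + a)..(b + a), ‖f t‖ ^ 2 := by
  have hint : ∀ l r, IntervalIntegrable (fun t => ‖f t‖ ^ 2) volume l r :=
    fun l r => (by fun_prop : Continuous fun t => ‖f t‖ ^ 2).intervalIntegrable l r
  have hpt : ∀ t, ‖(u * f (t + a) - v * f (t - a)) / (2 * Complex.I)‖ ^ 2
      ≤ (1 / 2) * ‖f (t + a)‖ ^ 2 + (1 / 2) * ‖f (t - a)‖ ^ 2 := by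
    intro t
    rw [norm_div, norm_mul, Complex.norm_I, Complex.norm_ofNat, mul_one]
    have h := norm_sub_le (u * f (t + a)) (v * f (t - a))
    rw [norm_mul, norm_mul, hu, hv, one_mul, one_mul] at h
    have h2 := pow_le_pow_left₀ (norm_nonneg _) h 2
    rw [div_pow]
    nlinarith [sq_nonneg (‖f (t + a)‖ - ‖f (t - a)‖)]
  have hmono : ∀ l r, -(b + a) ≤ l → l ≤ r → r ≤ b + a →
      ∫ t in l..r, ‖f t‖ ^ 2 ≤ ∫ t in -(b + a)..(b + a), ‖f t‖ ^ 2 := fun l r h1 h2 h3 =>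
    intervalIntegral.integral_mono_interval h1 h2 h3 (.of_forall fun t => by positivity) (hint _ _)
  have h1 := hmono (-b + a) (b + a) (by linarith) (by linarith) le_rfl
  have h2 := hmono (-b - a) (b - a) (by linarith) (by linarith) (by linarith)
  calc _ ≤ ∫ t in -b..b, ((1 / 2) * ‖f (t + a)‖ ^ 2 + (1 / 2) * ‖f (t - a)‖ ^ 2) := by
        refine intervalIntegral.integral_mono_on (by linarith) ?_ ?_ fun t _ => hpt t
        · exact (by fun_prop : Continuous fun t =>
            ‖(u * f (t + a) - v * f (t - a)) / (2 * Complex.I)‖ ^ 2).intervalIntegrable _ _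
        · exact (by fun_prop : Continuous fun t =>
            (1 / 2) * ‖f (t + a)‖ ^ 2 + (1 / 2) * ‖f (t - a)‖ ^ 2).intervalIntegrable _ _
    _ = (1 / 2) * (∫ t in (-b + a)..(b + a), ‖f t‖ ^ 2)
        + (1 / 2) * ∫ t in (-b - a)..(b - a), ‖f t‖ ^ 2 := by
        rw [intervalIntegral.integral_add, intervalIntegral.integral_const_mul,
          intervalIntegral.integral_const_mul,
          intervalIntegral.integral_comp_add_right (fun t => ‖f t‖ ^ 2),
          intervalIntegral.integral_comp_sub_right (fun t => ‖f t‖ ^ 2)]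
        · exact (by fun_prop : Continuous fun t =>
            (1 / 2) * ‖f (t + a)‖ ^ 2).intervalIntegrable _ _
        · exact (by fun_prop : Continuous fun t =>
            (1 / 2) * ‖f (t - a)‖ ^ 2).intervalIntegrable _ _
    _ ≤ _ := by linarith

/-- Exponentials are eigenfunctions of the modulated difference; the eigenvalue vanishes for the
frequency `x` of the modulation. -/
theorem modulated_difference_cexp (a t x z : ℝ) :
    (Complex.exp (Complex.I * (a : ℂ) * ((-x : ℝ) : ℂ)) *
        Complex.exp (Complex.I * ((t + a : ℝ) : ℂ) * (z : ℂ))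
      - Complex.exp (Complex.I * (a : ℂ) * (x : ℂ)) *
        Complex.exp (Complex.I * ((t - a : ℝ) : ℂ) * (z : ℂ))) / (2 * Complex.I)
    = (Real.sin (a * (z - x)) : ℂ) * Complex.exp (Complex.I * (t : ℂ) * (z : ℂ)) := by
  have h1 : Complex.exp (Complex.I * (a : ℂ) * ((-x : ℝ) : ℂ)) *
        Complex.exp (Complex.I * ((t + a : ℝ) : ℂ) * (z : ℂ))
      = Complex.exp ((a * (z - x) : ℂ) * Complex.I) *
        Complex.exp (Complex.I * (t : ℂ) * (z : ℂ)) := by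
    rw [← Complex.exp_add, ← Complex.exp_add]; congr 1; push_cast; ring
  have h2 : Complex.exp (Complex.I * (a : ℂ) * (x : ℂ)) *
        Complex.exp (Complex.I * ((t - a : ℝ) : ℂ) * (z : ℂ))
      = Complex.exp (-(a * (z - x) : ℂ) * Complex.I) *
        Complex.exp (Complex.I * (t : ℂ) * (z : ℂ)) := by
    rw [← Complex.exp_add, ← Complex.exp_add]; congr 1; push_cast; ring
  rw [h1, h2, Complex.ofReal_sin, Complex.sin]
  push_cast
  have hI : Complex.I ≠ 0 := Complex.I_ne_zero
  field_simp
  rw [Complex.I_sq]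
  ring

/-- A quantitative linear independence of exponentials: no combination of the `exp (i t x_k)` can
cancel `c₀ exp (i t y)` on an interval, because the modulated differences at the nodes
remove that combination and multiply `exp (i t y)` by the sines. -/
theorem prod_sin_sq_le_integral {ι : Type*} [DecidableEq ι] (x : ι → ℝ) (y : ℝ) {a : ℝ}
    (ha : 0 ≤ a) (s : Finset ι) :
    ∀ (b : ℝ) (_ : 0 ≤ b) (c₀ : ℂ) (c : ι → ℂ),
      2 * b * ‖c₀‖ ^ 2 * ∏ k ∈ s, Real.sin (a * (y - x k)) ^ 2
        ≤ ∫ t in -(b + s.card * a)..(b + s.card * a),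
          ‖c₀ * Complex.exp (Complex.I * (t : ℂ) * (y : ℂ))
            + ∑ k ∈ s, c k * Complex.exp (Complex.I * (t : ℂ) * (x k : ℂ))‖ ^ 2 := by
  induction s using Finset.induction_on with
  | empty =>
    intro b hb c₀ c
    simp only [Finset.prod_empty, Finset.card_empty, Finset.sum_empty, norm_mul, norm_cexp_I_mul,
      Nat.cast_zero, zero_mul, add_zero, mul_one, intervalIntegral.integral_const, smul_eq_mul]
    exact le_of_eq (by ring)
  | insert m s hm ih =>
    intro b hb c₀ c
    set f : ℝ → ℂ := fun t => c₀ * Complex.exp (Complex.I * (t : ℂ) * (y : ℂ))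
            + ∑ k ∈ insert m s, c k * Complex.exp (Complex.I * (t : ℂ) * (x k : ℂ)) with hfdef
    have hf : Continuous f := by fun_prop
    have h1 := ih b hb (c₀ * (Real.sin (a * (y - x m)) : ℂ))
      (fun k => c k * (Real.sin (a * (x k - x m)) : ℂ))
    have h2 := integral_sq_norm_modulated_difference_le hf (norm_cexp_I_mul a (-x m))
      (norm_cexp_I_mul a (x m)) ha (b := b + s.card * a) (by positivity)
    have h3 : ∀ t, (Complex.exp (Complex.I * (a : ℂ) * ((-x m : ℝ) : ℂ)) * f (t + a)
        - Complex.exp (Complex.I * (a : ℂ) * (x m : ℂ)) * f (t - a)) / (2 * Complex.I)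
        = c₀ * (Real.sin (a * (y - x m)) : ℂ) * Complex.exp (Complex.I * (t : ℂ) * (y : ℂ))
          + ∑ k ∈ s, c k * (Real.sin (a * (x k - x m)) : ℂ) *
            Complex.exp (Complex.I * (t : ℂ) * (x k : ℂ)) := by
      intro t
      have e : ∀ (z : ℝ) (C : ℂ), C * (Real.sin (a * (z - x m)) : ℂ) *
          Complex.exp (Complex.I * (t : ℂ) * (z : ℂ))
          = (Complex.exp (Complex.I * (a : ℂ) * ((-x m : ℝ) : ℂ)) *
              (C * Complex.exp (Complex.I * ((t + a : ℝ) : ℂ) * (z : ℂ)))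
            - Complex.exp (Complex.I * (a : ℂ) * (x m : ℂ)) *
              (C * Complex.exp (Complex.I * ((t - a : ℝ) : ℂ) * (z : ℂ)))) / (2 * Complex.I) := by
        intro z C
        rw [mul_assoc, ← modulated_difference_cexp]
        ring
      -- the term of the node `m` is annihilated, so it may be added to the sum
      have hz : ∑ k ∈ s, c k * (Real.sin (a * (x k - x m)) : ℂ) *
            Complex.exp (Complex.I * (t : ℂ) * (x k : ℂ))
          = ∑ k ∈ insert m s, c k * (Real.sin (a * (x k - x m)) : ℂ) *
            Complex.exp (Complex.I * (t : ℂ) * (x k : ℂ)) := by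
        rw [Finset.sum_insert hm]; simp
      rw [hz, e y c₀, Finset.sum_congr rfl fun k _ => e (x k) (c k), ← Finset.sum_div,
        Finset.sum_sub_distrib, ← add_div, ← Finset.mul_sum, ← Finset.mul_sum]
      congr 1
      simp only [hfdef]
      ring
    simp only [h3] at h2
    have hcard : b + ((insert m s).card : ℝ) * a = b + s.card * a + a := by
      rw [Finset.card_insert_of_notMem hm]; push_cast; ring
    rw [hcard]
    refine le_trans (le_trans (le_of_eq ?_) h1) h2
    rw [Finset.prod_insert hm, norm_mul, mul_pow, Complex.norm_real, Real.norm_eq_abs, sq_abs]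
    ring

/-! ### The exponent, its Legendre transform and the rate -/

/-- The properties of the exponent `S` that the estimates rely on: its derivative on `(0, ∞)` is
continuous, nonnegative and tends to infinity, and its graph lies above its tangents. -/
structure IsConvexExponent (S : ℝ → ℝ) : Prop where
  continuousOn_deriv : ContinuousOn (deriv S) (Set.Ioi 0)
  deriv_nonneg : ∀ t, 0 < t → 0 ≤ deriv S t
  tangent_le : ∀ u t, 0 < u → 0 < t → S u + deriv S u * (t - u) ≤ S t
  tendsto_deriv : Tendsto (deriv S) atTop atTop

theorem IsConvexExponent.of_contDiffOn {S : ℝ → ℝ} (hS : ContDiffOn ℝ 2 S (Set.Ioi 0))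
    (hS1 : ∀ t : ℝ, 0 < t → 0 ≤ deriv S t) (hS2 : ∀ t : ℝ, 0 < t → 0 ≤ deriv (deriv S) t)
    (hSlim : Tendsto (deriv S) atTop atTop) : IsConvexExponent S := by
  have hS' : ContDiffOn ℝ 1 (deriv S) (Set.Ioi 0) :=
    hS.deriv_of_isOpen isOpen_Ioi (by norm_num [one_add_one_eq_two])
  have hdiff : DifferentiableOn ℝ S (Set.Ioi 0) := hS.differentiableOn (by norm_num)
  have hconv : ConvexOn ℝ (Set.Ioi 0) S := by
    refine convexOn_of_deriv2_nonneg (convex_Ioi 0) hS.continuousOn ?_ ?_ ?_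
    · simpa using hdiff
    · simpa using hS'.differentiableOn (by norm_num)
    · intro t ht
      rw [interior_Ioi] at ht
      simpa using hS2 t ht
  refine ⟨hS'.continuousOn, hS1, fun u t hu ht => ?_, hSlim⟩
  have hd : DifferentiableAt ℝ S u := hdiff.differentiableAt (Ioi_mem_nhds hu)
  rcases lt_trichotomy u t with h | rfl | h
  · have := hconv.deriv_le_slope hu ht h hd
    rw [slope_def_field, le_div_iff₀ (by linarith)] at this
    linarith
  · simp
  · have := hconv.slope_le_deriv ht hu h hd
    rw [slope_def_field, div_le_iff₀ (by linarith)] at this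
    linarith

theorem IsConvexExponent.le_of_le {S : ℝ → ℝ} (hS : IsConvexExponent S) {u t : ℝ} (hu : 0 < u)
    (hut : u ≤ t) : S u ≤ S t := by
  have h := hS.tangent_le u t hu (hu.trans_le hut)
  have := mul_nonneg (hS.deriv_nonneg u hu) (sub_nonneg.2 hut)
  linarith

theorem IsConvexExponent.lower_bound {S : ℝ → ℝ} (hS : IsConvexExponent S) {t : ℝ} (ht : 0 < t) :
    S 1 - deriv S 1 ≤ S t := by
  have h := hS.tangent_le 1 t one_pos ht
  have := mul_nonneg (hS.deriv_nonneg 1 one_pos) ht.le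
  linarith

/-- The critical point equation of `q * log t - S t`, whose solution is the peak of
`t ^ q * exp (-S t)`. -/
theorem IsConvexExponent.exists_critical {S : ℝ → ℝ} (hS : IsConvexExponent S) {q : ℝ}
    (hq : deriv S 1 ≤ q) : ∃ u, 1 ≤ u ∧ u * deriv S u = q := by
  obtain ⟨M, hM1, hM⟩ := (tendsto_atTop.1 hS.tendsto_deriv (max q 0)).and
    (eventually_ge_atTop 1) |>.exists
  have hc : ContinuousOn (fun u => u * deriv S u) (Set.Icc 1 M) :=
    continuousOn_id.mul (hS.continuousOn_deriv.mono fun u hu => lt_of_lt_of_le one_pos hu.1)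
  have h := intermediate_value_Icc hM hc
  have hqM : q ≤ M * deriv S M := by
    have h1 : q ≤ deriv S M := (le_max_left _ _).trans hM1
    have h2 : 0 ≤ deriv S M := (le_max_right _ _).trans hM1
    nlinarith
  obtain ⟨u, hu, hu'⟩ := h ⟨by simpa using hq, hqM⟩
  exact ⟨u, hu.1, hu'⟩

/-- The tangent inequality for `S` and `log z ≤ z - 1` show that a critical point is a global
maximum, which is located at `s = log u`. -/
theorem IsConvexExponent.isGreatest {S T : ℝ → ℝ} (hS : IsConvexExponent S)
    (hT : ∀ s, T s = S (Real.exp s)) {q u : ℝ} (hq : 0 ≤ q) (hu : 0 < u)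
    (huq : u * deriv S u = q) :
    IsGreatest (Set.range fun s : ℝ => q * s - T s) (q * Real.log u - S u) := by
  refine ⟨⟨Real.log u, by simp [hT, Real.exp_log hu]⟩, ?_⟩
  rintro _ ⟨s, rfl⟩
  simp only [hT]
  have h := hS.tangent_le u (Real.exp s) hu (Real.exp_pos s)
  have hlog : s - Real.log u ≤ Real.exp s / u - 1 := by
    have := Real.add_one_le_exp (s - Real.log u)
    rw [Real.exp_sub, Real.exp_log hu] at this
    linarith
  have h2 := mul_le_mul_of_nonneg_left hlog hq
  have h3 : q * (Real.exp s / u - 1) = deriv S u * (Real.exp s - u) := by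
    rw [← huq]
    field_simp
  linarith

/-- The critical point is `o(q)`, because `S'` tends to infinity. -/
theorem IsConvexExponent.eventually_critical_le {S : ℝ → ℝ} (hS : IsConvexExponent S) {ε : ℝ}
    (hε : 0 < ε) :
    ∀ᶠ q : ℝ in atTop, ∀ u, 1 ≤ u → u * deriv S u = q → u ≤ ε * q := by
  obtain ⟨M, hM⟩ := eventually_atTop.1 (tendsto_atTop.1 hS.tendsto_deriv ε⁻¹)
  filter_upwards [eventually_ge_atTop (M / ε)] with q hq u hu huq
  rcases le_total M u with h | h
  · have h1 := mul_le_mul_of_nonneg_left (hM u h) (by linarith : 0 ≤ u)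
    rw [huq, ← div_eq_mul_inv, div_le_iff₀ hε] at h1
    linarith
  · rw [div_le_iff₀ hε] at hq
    linarith

/-- A choice of the critical point `τ q` for every large `q`. -/
theorem IsConvexExponent.exists_maximizer {S T : ℝ → ℝ} (hS : IsConvexExponent S)
    (hT : ∀ s, T s = S (Real.exp s)) :
    ∃ τ : ℝ → ℝ,
      (∀ᶠ q : ℝ in atTop, 1 ≤ τ q ∧ τ q * deriv S (τ q) = q ∧
        IsGreatest (Set.range fun s : ℝ => q * s - T s) (q * Real.log (τ q) - S (τ q)) ∧
        legendreTransform T q = q * Real.log (τ q) - S (τ q)) ∧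
      ∀ ε > 0, ∀ᶠ q : ℝ in atTop, τ q ≤ ε * q := by
  choose! τ hτ using fun q (hq : deriv S 1 ≤ q) => hS.exists_critical hq
  refine ⟨τ, ?_, fun ε hε => ?_⟩
  · filter_upwards [eventually_ge_atTop (deriv S 1), eventually_ge_atTop 0] with q hq hq0
    have h := hS.isGreatest hT hq0 (by linarith [(hτ q hq).1]) (hτ q hq).2
    exact ⟨(hτ q hq).1, (hτ q hq).2, h, h.csSup_eq⟩
  · filter_upwards [hS.eventually_critical_le hε, eventually_ge_atTop (deriv S 1)] with q h hq
    exact h _ (hτ q hq).1 (hτ q hq).2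

theorem tendsto_two_mul_add_one_atTop :
    Tendsto (fun K : ℕ => 2 * (K : ℝ) + 1) atTop atTop :=
  tendsto_atTop_add_const_right _ _
    (tendsto_natCast_atTop_atTop.const_mul_atTop two_pos)

/-- If `u` is the critical point for `2 K + 3`, testing the supremum for `2 K + 1` at `log u` gives
`F (K + 1) - F K ≤ 2 log (u / (K + 1))`, which is negative as soon as `u < K + 1`. -/
theorem IsConvexExponent.eventually_rateF_succ_lt {S T : ℝ → ℝ} (hS : IsConvexExponent S)
    (hT : ∀ s, T s = S (Real.exp s)) :
    ∀ᶠ K : ℕ in atTop, rateF T (K + 1 : ℕ) < rateF T K := by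
  obtain ⟨τ, h1, h2⟩ := hS.exists_maximizer hT
  have hK := tendsto_two_mul_add_one_atTop
  have hK1 := hK.comp (tendsto_add_atTop_nat 1)
  filter_upwards [hK.eventually h1, hK1.eventually h1, hK1.eventually (h2 (1 / 4) (by norm_num)),
    eventually_ge_atTop 1] with K ha hb hc hK0
  simp only [Function.comp_apply] at hb hc
  obtain ⟨hb1, hbq, hbG, hbL⟩ := hb
  obtain ⟨ha1, haq, haG, haL⟩ := ha
  have hKpos : (1 : ℝ) ≤ K := by exact_mod_cast hK0
  set u := τ (2 * ((K + 1 : ℕ) : ℝ) + 1) with hu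
  rw [rateF, rateF, hbL, haL]
  have hmem : (2 * (K : ℝ) + 1) * Real.log u - S u
      ≤ (2 * (K : ℝ) + 1) * Real.log (τ (2 * (K : ℝ) + 1)) - S (τ (2 * (K : ℝ) + 1)) :=
    haG.2 ⟨Real.log u, by simp [hT, Real.exp_log (by linarith : 0 < u)]⟩
  push_cast at hc ⊢
  have hlog1 : Real.log u < Real.log (K + 1) := Real.log_lt_log (by linarith) (by linarith)
  have hlog2 : Real.log K ≤ Real.log (K + 1) := Real.log_le_log (by linarith) (by linarith)
  have := mul_nonneg (by linarith : 0 ≤ 2 * (K : ℝ) + 1) (sub_nonneg.2 hlog2)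
  linarith

theorem IsConvexExponent.exists_strictAntiOn_rateF {S T : ℝ → ℝ} (hS : IsConvexExponent S)
    (hT : ∀ s, T s = S (Real.exp s)) :
    ∃ K₀ : ℕ, StrictAntiOn (fun K : ℕ => rateF T K) (Set.Ici K₀) := by
  obtain ⟨K₀, h⟩ := eventually_atTop.1 (hS.eventually_rateF_succ_lt hT)
  exact ⟨K₀, strictAntiOn_of_succ_lt Set.ordConnected_Ici fun K _ hK _ => h K hK⟩

theorem IsConvexExponent.tendsto_rateF_div {S T : ℝ → ℝ} (hS : IsConvexExponent S)
    (hT : ∀ s, T s = S (Real.exp s)) :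
    Tendsto (fun K : ℕ => rateF T K / K) atTop atBot := by
  obtain ⟨τ, h1, h2⟩ := hS.exists_maximizer hT
  have hK := tendsto_two_mul_add_one_atTop
  refine tendsto_atBot.2 fun b => ?_
  -- `τ ≤ K exp (-B)` makes `F K / K ≤ -2 B + C`
  set C := |S 1 - deriv S 1| with hC
  set B := max (C - b) 0 with hB
  filter_upwards [hK.eventually h1, hK.eventually (h2 (Real.exp (-B) / 3) (by positivity)),
    eventually_ge_atTop 1] with K ⟨ha1, haq, haG, haL⟩ hc hK0
  have hKpos : (1 : ℝ) ≤ K := by exact_mod_cast hK0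
  set u := τ (2 * (K : ℝ) + 1) with hu
  have hu' : u ≤ Real.exp (-B) * K := by
    have : Real.exp (-B) / 3 * (2 * K + 1) ≤ Real.exp (-B) * K := by
      nlinarith [Real.exp_pos (-B)]
    linarith
  have hlog : Real.log u ≤ -B + Real.log K := by
    have := Real.log_le_log (by linarith : 0 < u) hu'
    rwa [Real.log_mul (Real.exp_pos _).ne' (by positivity), Real.log_exp] at this
  have hlow := hS.lower_bound (by linarith : 0 < u)
  have hCabs : -C ≤ S 1 - deriv S 1 := neg_abs_le _
  have hC0 : 0 ≤ C := abs_nonneg _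
  have hB0 : 0 ≤ B := le_max_right _ _
  have hBb : C - b ≤ B := le_max_left _ _
  rw [rateF, haL, div_le_iff₀ (by linarith)]
  have h3 := mul_le_mul_of_nonneg_left hlog (by linarith : 0 ≤ 2 * (K : ℝ) + 1)
  nlinarith

/-! ### Conditional variance of Gaussian processes -/

/-- The conditional variance of an observable part plus an independent centered part is the constant
second moment of the latter. -/
theorem condVar_add_ae_eq_of_indep {Ω : Type*} {m mΩ : MeasurableSpace Ω} {P : Measure Ω}
    [IsProbabilityMeasure P] (hm : m ≤ mΩ) {Z R : Ω → ℝ}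
    (hZm : StronglyMeasurable[m] Z) (hZint : Integrable Z P)
    (hR : Measurable R) (hRint : Integrable R P) (hR0 : P[R] = 0)
    (hind : Indep (MeasurableSpace.comap R inferInstance) m P) :
    condVar m (Z + R) P =ᵐ[P] fun _ => P[fun ω => R ω ^ 2] := by
  have hcondR : P[R | m] =ᵐ[P] fun _ => P[R] :=
    condExp_indep_eq hR.comap_le hm (comap_measurable R).stronglyMeasurable hind
  have hcondR2 : P[fun ω => R ω ^ 2 | m] =ᵐ[P] fun _ => P[fun ω => R ω ^ 2] :=
    condExp_indep_eq hR.comap_le hm ((comap_measurable R).pow_const 2).stronglyMeasurable hind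
  have hcondY : P[Z + R | m] =ᵐ[P] Z := by
    refine (condExp_add hZint hRint m).trans ?_
    rw [condExp_of_stronglyMeasurable hm hZm hZint]
    filter_upwards [hcondR] with ω h
    simp [h, hR0]
  refine EventuallyEq.trans (condExp_congr_ae ?_) hcondR2
  filter_upwards [hcondY] with ω h
  simp [h]

theorem IsCenteredGaussian.condVar_ae_eq {D Ω : Type*} [MeasurableSpace Ω] {P : Measure Ω}
    [IsProbabilityMeasure P] {ξ : D → Ω → ℝ} {k : D → D → ℝ} (hξ : IsCenteredGaussian P ξ k)
    (hk : ∀ x y, k x y = k y x)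
    {K : ℕ} (x : D) (p : Fin K → D) (hM : IsUnit (kernelMatrix k p).det) :
    condVar (MeasurableSpace.comap (fun ω i => ξ (p i) ω) MeasurableSpace.pi) (ξ x) P
      =ᵐ[P] fun _ => gaussianCondVariance k x p := by
  have hL2 : ∀ y, MemLp (ξ y) 2 P := fun y => (hξ.gaussian.hasGaussianLaw_eval y).memLp_two
  have hint : ∀ y, Integrable (ξ y) P := fun y => (hL2 y).integrable one_le_two
  have hprod : ∀ y z, Integrable (fun ω => ξ y ω * ξ z ω) P :=
    fun y z => (hL2 y).integrable_mul (hL2 z)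
  set g := kernelVector k x p with hg
  set M := kernelMatrix k p with hMdef
  set c := M⁻¹.mulVec g with hc
  have hMc : M.mulVec c = g := by
    rw [hc, Matrix.mulVec_mulVec, Matrix.mul_nonsing_inv _ hM, Matrix.one_mulVec]
  set R : Ω → ℝ := fun ω => ξ x ω - ∑ i, c i * ξ (p i) ω with hR
  have hRm : Measurable R :=
    (hξ.measurable x).sub (Finset.measurable_sum _ fun i _ => (hξ.measurable _).const_mul _)
  have hRL2 : MemLp R 2 P :=
    (hL2 x).sub (memLp_finsetSum _ fun i _ => (hL2 (p i)).const_mul _)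
  have hR0 : P[R] = 0 := by
    simp only [hR]
    rw [integral_sub (hint x) (integrable_finsetSum _ fun i _ => (hint _).const_mul _),
      integral_finsetSum _ fun i _ => (hint _).const_mul _]
    simp [integral_const_mul, hξ.centered]
  -- the residual is orthogonal to the observations
  have hRcov : ∀ y, P[fun ω => R ω * ξ y ω] = k x y - ∑ i, c i * k (p i) y := by
    intro y
    have : (fun ω => R ω * ξ y ω)
        = fun ω => ξ x ω * ξ y ω - ∑ i, c i * (ξ (p i) ω * ξ y ω) := by
      funext ω
      simp only [hR, sub_mul, Finset.sum_mul, mul_assoc]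
    rw [this, integral_sub (hprod x y)
      (integrable_finsetSum _ fun i _ => (hprod _ _).const_mul _),
      integral_finsetSum _ fun i _ => (hprod _ _).const_mul _]
    simp only [integral_const_mul, hξ.covariance]
  have hRorth : ∀ j, P[fun ω => R ω * ξ (p j) ω] = 0 := by
    intro j
    have h := congrFun hMc j
    simp only [Matrix.mulVec, dotProduct, hMdef, kernelMatrix, Matrix.of_apply, hg,
      kernelVector] at h
    rw [hRcov, ← h, sub_eq_zero]
    exact Finset.sum_congr rfl fun i _ => by rw [hk (p j), mul_comm]
  have hRsq : P[fun ω => R ω ^ 2] = gaussianCondVariance k x p := by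
    have : (fun ω => R ω ^ 2)
        = fun ω => R ω * ξ x ω - ∑ i, c i * (R ω * ξ (p i) ω) := by
      funext ω
      rw [sq]
      nth_rw 2 [hR]
      simp only [mul_sub, Finset.mul_sum, mul_left_comm]
    have hRp : ∀ y, Integrable (fun ω => R ω * ξ y ω) P := fun y => hRL2.integrable_mul (hL2 y)
    rw [this, integral_sub (hRp x) (integrable_finsetSum _ fun i _ => (hRp _).const_mul _),
      integral_finsetSum _ fun i _ => (hRp _).const_mul _]
    simp only [integral_const_mul, hRorth, hRcov, mul_zero, Finset.sum_const_zero, sub_zero]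
    rw [gaussianCondVariance, ← hg, ← hMdef, ← hc]
    simp only [dotProduct, hg, kernelVector]
    congr 1
    exact Finset.sum_congr rfl fun i _ => by rw [hk (p i), mul_comm]
  -- `Unit` carries the residual, so that the independence of jointly Gaussian families applies
  have hgauss : IsGaussianProcess
      (Sum.elim (fun _ : Unit => R) (fun i : Fin K => ξ (p i))) P := by
    classical
    refine hξ.gaussian.of_isGaussianProcess fun s => ?_
    rcases s with _ | i
    · let I : Finset D := insert x (Finset.univ.image p)
      refine ⟨I, ContinuousLinearMap.proj (⟨x, by simp [I]⟩ : I)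
        - ∑ i, c i • ContinuousLinearMap.proj (⟨p i, by simp [I]⟩ : I), fun ω => ?_⟩
      simp [hR, Finset.restrict]
    · exact ⟨{p i}, ContinuousLinearMap.proj (⟨p i, by simp⟩ : ({p i} : Finset D)),
        fun ω => by simp [Finset.restrict]⟩
  have hind0 := hgauss.indepFun_of_covariance_eq_zero (fun _ => hRm.aemeasurable)
    (fun i => (hξ.measurable (p i)).aemeasurable) fun _ j => by
      rw [covariance_eq_sub hRL2 (hL2 _), hR0, zero_mul, sub_zero]
      exact hRorth j
  have hind : IndepFun R (fun ω i => ξ (p i) ω) P :=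
    hind0.comp (measurable_pi_apply ()) measurable_id
  have hdecomp : ξ x = (fun ω => ∑ i, c i * ξ (p i) ω) + R := by
    funext ω
    simp [hR]
  have hobs : Measurable fun ω i => ξ (p i) ω :=
    measurable_pi_lambda _ fun i => hξ.measurable (p i)
  rw [← hRsq, hdecomp]
  refine condVar_add_ae_eq_of_indep hobs.comap_le (Measurable.stronglyMeasurable ?_)
    (integrable_finsetSum _ fun i _ => (hint _).const_mul _) hRm (hRL2.integrable one_le_two)
    hR0 hind
  exact (by fun_prop : Measurable fun z : Fin K → ℝ => ∑ i, c i * z i).comp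
    (comap_measurable fun ω i => ξ (p i) ω)

/-! ### The two-sided bound -/

/-- The density is at least `exp (-S r)` on `[-r, r]`, since it decreases in `|t|`. -/
theorem mul_intervalIntegral_le_integral {Ghat S : ℝ → ℝ}
    (hGS : ∀ t : ℝ, t ≠ 0 → Ghat t = Real.exp (-S |t|)) (hS : IsConvexExponent S) {f : ℝ → ℝ}
    (hf : Continuous f) (hf0 : ∀ t, 0 ≤ f t) (hint : Integrable fun t => Ghat t * f t)
    {r : ℝ} (hr : 0 < r) :
    Real.exp (-S r) * ∫ t in -r..r, f t ≤ ∫ t, Ghat t * f t := by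
  have hne : ∀ᵐ t : ℝ, t ≠ 0 := by simp [ae_iff]
  rw [← intervalIntegral.integral_const_mul, intervalIntegral.integral_of_le (by linarith)]
  refine le_trans ?_ (setIntegral_le_integral (s := Set.Ioc (-r) r) hint ?_)
  · refine setIntegral_mono_on_ae ?_ hint.integrableOn measurableSet_Ioc ?_
    · exact ((by fun_prop : Continuous fun t => Real.exp (-S r) * f t).integrableOn_Icc).mono_set
        Set.Ioc_subset_Icc_self
    · filter_upwards [hne] with t ht htr
      rw [hGS t ht]
      have h := hS.le_of_le (abs_pos.2 ht) (abs_le.2 ⟨htr.1.le, htr.2⟩)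
      exact mul_le_mul_of_nonneg_right (Real.exp_le_exp.2 (by linarith)) (hf0 t)
  · filter_upwards [hne] with t ht
    rw [hGS t ht]
    exact mul_nonneg (Real.exp_pos _).le (hf0 t)

theorem posDef_kernelMatrix {Ghat G S : ℝ → ℝ} (hG : IsSpectralDensity Ghat G)
    (hGS : ∀ t : ℝ, t ≠ 0 → Ghat t = Real.exp (-S |t|)) (hS : IsConvexExponent S)
    {K : ℕ} {p : Fin K → Set.Icc (-1 : ℝ) 1} (hp : Function.Injective p) :
    (kernelMatrix (stationaryKernel G) p).PosDef := by
  refine Matrix.PosDef.of_dotProduct_mulVec_pos ?_ fun v hv => ?_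
  · ext i j
    simp only [Matrix.conjTranspose_apply, kernelMatrix, Matrix.of_apply, stationaryKernel,
      star_trivial]
    rw [← hG.even, neg_sub]
  obtain ⟨j, hj⟩ := Function.ne_iff.1 hv
  obtain ⟨hint, heq⟩ := hG.integrable_and_sum_eq_integral (fun k => (p k : ℝ)) v
  have hquad : star v ⬝ᵥ (kernelMatrix (stationaryKernel G) p).mulVec v
      = ∑ i, ∑ j, v i * v j * G ((p i : ℝ) - p j) := by
    simp only [star_trivial, dotProduct, Matrix.mulVec, kernelMatrix, Matrix.of_apply,
      stationaryKernel, Finset.mul_sum]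
    exact Finset.sum_congr rfl fun i _ => Finset.sum_congr rfl fun j _ => by ring
  rw [hquad, heq]
  have h1 := prod_sin_sq_le_integral (fun k => (p k : ℝ)) (p j) zero_le_one
    (Finset.univ.erase j) 1 zero_le_one (v j) (fun k => (v k : ℂ))
  have hsum : ∀ t : ℝ, (v j : ℂ) * Complex.exp (Complex.I * (t : ℂ) * ((p j : ℝ) : ℂ))
      + ∑ k ∈ Finset.univ.erase j, (v k : ℂ) * Complex.exp (Complex.I * (t : ℂ) * ((p k : ℝ) : ℂ))
      = ∑ k, (v k : ℂ) * Complex.exp (Complex.I * (t : ℂ) * ((p k : ℝ) : ℂ)) := fun t =>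
    Finset.add_sum_erase Finset.univ
      (fun k => (v k : ℂ) * Complex.exp (Complex.I * (t : ℂ) * ((p k : ℝ) : ℂ)))
      (Finset.mem_univ j)
  simp only [hsum] at h1
  have h2 := mul_intervalIntegral_le_integral hGS hS
    (f := fun t => ‖∑ k, (v k : ℂ) * Complex.exp (Complex.I * (t : ℂ) * ((p k : ℝ) : ℂ))‖ ^ 2)
    (by fun_prop) (fun t => by positivity) hint
    (r := 1 + ((Finset.univ.erase j).card : ℝ) * 1) (by positivity)
  refine lt_of_lt_of_le (mul_pos (Real.exp_pos _) (lt_of_lt_of_le ?_ h1)) h2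
  have hj' : v j ≠ 0 := hj
  refine mul_pos (by simpa using by positivity) (Finset.prod_pos fun k hk => ?_)
  have hne : (p j : ℝ) - p k ≠ 0 := by
    rw [sub_ne_zero]
    exact fun h => (Finset.ne_of_mem_erase hk) (hp (Subtype.ext h)).symm
  -- the nodes are less than `π` apart
  have hlt : |(p j : ℝ) - p k| < Real.pi := by
    have h1 := (p j).2
    have h2 := (p k).2
    rw [abs_lt]
    constructor <;> linarith [h1.1, h1.2, h2.1, h2.2, Real.pi_gt_three]
  rw [one_mul]
  refine pow_pos ?_ 2 |>.trans_eq (sq_abs _)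
  rw [Real.abs_sin_eq_sin_abs_of_abs_le_pi hlt.le]
  exact Real.sin_pos_of_pos_of_lt_pi (abs_pos.2 hne) hlt

/-- Integrability is read off the nonzero value of the integral. -/
theorem integrable_and_integral_abs_pow_mul_exp (n : ℕ) {r : ℝ} (hr : 0 < r) :
    (Integrable fun t : ℝ => |t| ^ n * Real.exp (-(r * |t|))) ∧
    ∫ t : ℝ, |t| ^ n * Real.exp (-(r * |t|)) = 2 * (n.factorial / r ^ (n + 1)) := by
  have hI := Real.integral_rpow_mul_exp_neg_mul_Ioi (a := n + 1) (by positivity) hr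
  simp only [add_sub_cancel_right, Real.rpow_natCast, Real.Gamma_nat_eq_factorial] at hI
  have hval : ∫ t in Set.Ioi (0 : ℝ), t ^ n * Real.exp (-(r * t)) = n.factorial / r ^ (n + 1) := by
    rw [hI, one_div, Real.inv_rpow hr.le, div_eq_mul_inv, mul_comm]
    norm_cast
  have hcomp := integral_comp_abs (f := fun t => t ^ n * Real.exp (-(r * t)))
  constructor
  · by_contra h
    rw [integral_undef h, hval] at hcomp
    have : 0 < (n.factorial : ℝ) / r ^ (n + 1) := by positivity
    linarith
  · rw [hcomp, hval]

/-- `|t| ^ n * exp (-S |t|)` is dominated by the Gamma integrand obtained by replacing `S` with its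
tangent at `u`. -/
theorem abs_pow_mul_le {Ghat S : ℝ → ℝ}
    (hGS : ∀ t : ℝ, t ≠ 0 → Ghat t = Real.exp (-S |t|)) (hS : IsConvexExponent S)
    (n : ℕ) {u : ℝ} (hu : 0 < u) {t : ℝ} (ht : t ≠ 0) :
    Ghat t * |t| ^ n
      ≤ Real.exp (u * deriv S u - S u) * (|t| ^ n * Real.exp (-(deriv S u * |t|))) := by
  rw [hGS t ht, mul_left_comm, ← Real.exp_add, mul_comm]
  refine mul_le_mul_of_nonneg_left (Real.exp_le_exp.2 ?_) (by positivity)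
  have := hS.tangent_le u |t| hu (abs_pos.2 ht)
  linarith

/-- A residual that vanishes at `t = 0` to order `K` is integrated against the Gamma majorant of the
density. -/
theorem residualEnergy_le {Ghat G S : ℝ → ℝ} (hG : IsSpectralDensity Ghat G)
    (hGS : ∀ t : ℝ, t ≠ 0 → Ghat t = Real.exp (-S |t|)) (hS : IsConvexExponent S)
    {K : ℕ} (x : ℝ) (p c : Fin K → ℝ) {A : ℝ}
    (hA : ∀ t : ℝ, ‖Complex.exp (Complex.I * (t : ℂ) * (x : ℂ))
        - ∑ k, (c k : ℂ) * Complex.exp (Complex.I * (t : ℂ) * (p k : ℂ))‖ ≤ |t| ^ K * A)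
    {u : ℝ} (hu : 0 < u) (hd : 0 < deriv S u) :
    residualEnergy Ghat x p c
      ≤ A ^ 2 * (Real.exp (u * deriv S u - S u) *
        (2 * ((2 * K).factorial / deriv S u ^ (2 * K + 1)))) := by
  obtain ⟨hI, hval⟩ := integrable_and_integral_abs_pow_mul_exp (2 * K) hd
  have hne : ∀ᵐ t : ℝ, t ≠ 0 := by simp [ae_iff]
  rw [residualEnergy, ← hval, ← integral_const_mul, ← integral_const_mul]
  refine integral_mono_ae (hG.integrable_residual x p c) ((hI.const_mul _).const_mul _) ?_
  filter_upwards [hne] with t ht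
  have h1 := abs_pow_mul_le hGS hS (2 * K) hu ht
  have h2 := pow_le_pow_left₀ (norm_nonneg _) (hA t) 2
  have h0 : 0 ≤ Ghat t := by rw [hGS t ht]; exact (Real.exp_pos _).le
  calc _ ≤ Ghat t * (|t| ^ K * A) ^ 2 := mul_le_mul_of_nonneg_left h2 h0
    _ = A ^ 2 * (Ghat t * |t| ^ (2 * K)) := by ring
    _ ≤ _ := mul_le_mul_of_nonneg_left h1 (sq_nonneg A)

/-- The comparison of constants in the upper bound:
`2 e (2 K choose K) (K / (2 K + 1)) ^ (2 K + 1) ≤ 1`, cleared of denominators. -/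
theorem two_mul_exp_mul_factorial_div_le {K : ℕ} (hK : 1 ≤ K) :
    2 * Real.exp (2 * K + 1) * (2 * K).factorial * (K : ℝ) ^ (2 * K + 1)
      ≤ Real.exp (2 * K) * (K.factorial : ℝ) ^ 2 * (2 * K + 1) ^ (2 * K + 1) := by
  have hfac : ((2 * K).factorial : ℝ) ≤ 2 ^ (2 * K) * (K.factorial : ℝ) ^ 2 := by
    have h := Nat.choose_mul_factorial_mul_factorial (show K ≤ 2 * K by omega)
    have h2 := Nat.choose_le_two_pow (2 * K) K
    rw [show 2 * K - K = K by omega] at h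
    have : (2 * K).factorial ≤ 2 ^ (2 * K) * K.factorial ^ 2 := by
      rw [← h, mul_assoc, ← sq]
      exact Nat.mul_le_mul_right _ h2
    exact_mod_cast this
  have hpow : (2 * (K : ℝ)) ^ (2 * K + 1) ≤ Real.exp (-1) * (2 * K + 1) ^ (2 * K + 1) := by
    have h := Real.one_sub_div_pow_le_exp_neg (n := 2 * K + 1) (t := 1) (by push_cast; linarith)
    have e : (1 : ℝ) - 1 / ((2 * K + 1 : ℕ) : ℝ) = 2 * K / (2 * K + 1) := by
      push_cast
      field_simp
      ring
    rw [e, div_pow, div_le_iff₀ (by positivity)] at h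
    exact h
  have he : Real.exp (2 * K + 1) * Real.exp (-1) = Real.exp (2 * K) := by
    rw [← Real.exp_add]; congr 1; ring
  calc 2 * Real.exp (2 * K + 1) * (2 * K).factorial * (K : ℝ) ^ (2 * K + 1)
      ≤ 2 * Real.exp (2 * K + 1) * (2 ^ (2 * K) * (K.factorial : ℝ) ^ 2) *
        (K : ℝ) ^ (2 * K + 1) := by gcongr
    _ = Real.exp (2 * K + 1) * (K.factorial : ℝ) ^ 2 * (2 * (K : ℝ)) ^ (2 * K + 1) := by
        rw [mul_pow, pow_succ 2]; ring
    _ ≤ Real.exp (2 * K + 1) * (K.factorial : ℝ) ^ 2 *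
        (Real.exp (-1) * (2 * K + 1) ^ (2 * K + 1)) := by gcongr
    _ = _ := by rw [← he]; ring

theorem sq_mul_le_sin_sq {z : ℝ} (hz : |z| ≤ 1) : 25 / 36 * z ^ 2 ≤ Real.sin z ^ 2 := by
  rcases eq_or_ne z 0 with rfl | h0
  · simp
  have hpos := abs_pos.2 h0
  have h := Real.sin_gt_sub_cube hpos
  have h1 : 5 / 6 * |z| ≤ Real.sin |z| := by nlinarith [sq_nonneg |z|, mul_pos hpos hpos]
  rw [← sq_abs (Real.sin z), Real.abs_sin_eq_sin_abs_of_abs_le_pi (by linarith [Real.pi_gt_three]),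
    ← sq_abs z]
  calc 25 / 36 * |z| ^ 2 = (5 / 6 * |z|) ^ 2 := by ring
    _ ≤ _ := pow_le_pow_left₀ (by positivity) h1 2

/-- The comparison of constants in the lower bound: `(1 + 1 / K) ^ (2 K + 1) ≤ e ^ 3` and
`25 / 36 ≥ exp (-1 / 2)`, so the losses stay below `exp K`. -/
theorem exp_neg_mul_pow_succ_le {K : ℕ} (hK : 6 ≤ K) :
    Real.exp (-(K : ℝ)) * ((K : ℝ) + 1) ^ (2 * K + 1)
      ≤ 2 * (25 / 36) ^ K * (K : ℝ) ^ (2 * K + 1) := by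
  have hK' : (6 : ℝ) ≤ K := by exact_mod_cast hK
  have h1 : ((K : ℝ) + 1) ^ (2 * K + 1) ≤ Real.exp 3 * (K : ℝ) ^ (2 * K + 1) := by
    have e : (K : ℝ) + 1 ≤ Real.exp (1 / K) * K := by
      have := mul_le_mul_of_nonneg_right (Real.add_one_le_exp (1 / (K : ℝ)))
        (by linarith : 0 ≤ (K : ℝ))
      rwa [add_mul, one_div_mul_cancel (by positivity), one_mul, add_comm] at this
    refine (pow_le_pow_left₀ (by positivity) e _).trans ?_
    rw [mul_pow, ← Real.exp_nat_mul]
    refine mul_le_mul_of_nonneg_right (Real.exp_le_exp.2 ?_) (by positivity)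
    rw [mul_one_div, div_le_iff₀ (by positivity)]
    push_cast
    linarith
  have h2 : Real.exp (-(K : ℝ) / 2) ≤ (25 / 36) ^ K := by
    have : Real.exp (-1 / 2) ≤ 25 / 36 := by
      rw [← abs_of_pos (Real.exp_pos (-1 / 2)), ← abs_of_pos (by norm_num : (0 : ℝ) < 25 / 36),
        ← sq_le_sq, sq, ← Real.exp_add, show (-1 / 2 + -1 / 2 : ℝ) = -1 by norm_num,
        Real.exp_neg, inv_le_comm₀ (Real.exp_pos 1) (by norm_num)]
      have := Real.exp_one_gt_d9
      norm_num
      linarith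
    calc Real.exp (-(K : ℝ) / 2) = Real.exp (-1 / 2) ^ K := by
          rw [← Real.exp_nat_mul]; congr 1; ring
      _ ≤ _ := pow_le_pow_left₀ (Real.exp_pos _).le this K
  calc Real.exp (-(K : ℝ)) * ((K : ℝ) + 1) ^ (2 * K + 1)
      ≤ Real.exp (-(K : ℝ)) * (Real.exp 3 * (K : ℝ) ^ (2 * K + 1)) := by gcongr
    _ = Real.exp (-(K : ℝ) + 3) * (K : ℝ) ^ (2 * K + 1) := by rw [Real.exp_add]; ring
    _ ≤ Real.exp (-(K : ℝ) / 2) * (K : ℝ) ^ (2 * K + 1) := by gcongr; linarith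
    _ ≤ (25 / 36) ^ K * (K : ℝ) ^ (2 * K + 1) := by gcongr
    _ ≤ 2 * (25 / 36) ^ K * (K : ℝ) ^ (2 * K + 1) := by
        have : 0 ≤ (25 / 36 : ℝ) ^ K * (K : ℝ) ^ (2 * K + 1) := by positivity
        linarith

/-- `prod_sin_sq_le_integral` on the interval of radius `(K + 1) a`, with the sines bounded below by
`5 / 6` of their arguments. -/
theorem le_residualEnergy {Ghat G S : ℝ → ℝ} (hG : IsSpectralDensity Ghat G)
    (hGS : ∀ t : ℝ, t ≠ 0 → Ghat t = Real.exp (-S |t|)) (hS : IsConvexExponent S)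
    {K : ℕ} (x : ℝ) (p c : Fin K → ℝ) (hxp : ∀ k, |x - p k| ≤ 2) {a : ℝ} (ha : 0 < a)
    (ha' : a ≤ 1 / 2) :
    Real.exp (-S ((K + 1) * a)) * (2 * a ^ (2 * K + 1) * (25 / 36) ^ K * ∏ k, |x - p k| ^ 2)
      ≤ residualEnergy Ghat x p c := by
  have h1 := prod_sin_sq_le_integral p x ha.le Finset.univ a ha.le 1 (fun k => -(c k : ℂ))
  have h2 := mul_intervalIntegral_le_integral hGS hS (by fun_prop) (fun t => by positivity)
    (hG.integrable_residual x p c) (r := (K + 1) * a) (by positivity)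
  refine le_trans (mul_le_mul_of_nonneg_left ?_ (Real.exp_pos _).le) h2
  have hr : a + ((Finset.univ : Finset (Fin K)).card : ℝ) * a = (K + 1) * a := by
    rw [Finset.card_univ, Fintype.card_fin]; ring
  simp only [hr, one_mul, neg_mul, Finset.sum_neg_distrib, ← sub_eq_add_neg, norm_one, one_pow,
    mul_one] at h1
  refine le_trans ?_ h1
  have h3 : ∏ k, (25 / 36 * a ^ 2 * |x - p k| ^ 2) ≤ ∏ k, Real.sin (a * (x - p k)) ^ 2 := by
    refine Finset.prod_le_prod (fun k _ => by positivity) fun k _ => ?_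
    refine le_trans (le_of_eq ?_) (sq_mul_le_sin_sq (z := a * (x - p k)) ?_)
    · rw [sq_abs]; ring
    · rw [abs_mul, abs_of_pos ha]
      nlinarith [hxp k, abs_nonneg (x - p k)]
  rw [Finset.prod_mul_distrib, Finset.prod_const, Finset.card_univ, Fintype.card_fin] at h3
  have h4 := mul_le_mul_of_nonneg_left h3 (by linarith : 0 ≤ 2 * a)
  refine le_trans (le_of_eq ?_) h4
  rw [mul_pow, ← pow_mul, pow_succ]
  ring

theorem exp_rateF {T : ℝ → ℝ} {K : ℕ} (hK : 1 ≤ K) {u s : ℝ} (hu : 0 < u)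
    (h : legendreTransform T (2 * K + 1) = (2 * K + 1) * Real.log u - s) :
    Real.exp (rateF T K) = u ^ (2 * K + 1) * Real.exp (-s) / (K : ℝ) ^ (2 * K + 1) := by
  have hK0 : (0 : ℝ) < K := by exact_mod_cast hK
  have e : ∀ z : ℝ, 0 < z → Real.exp ((2 * K + 1) * Real.log z) = z ^ (2 * K + 1) := by
    intro z hz
    rw [show (2 * (K : ℝ) + 1) = ((2 * K + 1 : ℕ) : ℝ) by push_cast; ring, Real.exp_nat_mul,
      Real.exp_log hz]
  rw [rateF, h, Real.exp_sub, sub_eq_add_neg, Real.exp_add, e u hu, e K hK0]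

theorem eventually_condVariance_bounds {Ghat G S T : ℝ → ℝ} (hG : IsSpectralDensity Ghat G)
    (hGS : ∀ t : ℝ, t ≠ 0 → Ghat t = Real.exp (-S |t|)) (hS : IsConvexExponent S)
    (hT : ∀ s, T s = S (Real.exp s)) :
    ∀ᶠ K : ℕ in atTop, ∀ (x : Set.Icc (-1 : ℝ) 1) (p : Fin K → Set.Icc (-1 : ℝ) 1),
      Function.Injective p → (∀ k, x ≠ p k) →
      Real.exp (-(K : ℝ)) ≤
          gaussianCondVariance (stationaryKernel G) x p /
            (Real.exp (rateF T K) * ∏ k, |(x : ℝ) - (p k : ℝ)| ^ 2) ∧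
        gaussianCondVariance (stationaryKernel G) x p /
            (Real.exp (rateF T K) * ∏ k, |(x : ℝ) - (p k : ℝ)| ^ 2) ≤
          Real.exp (2 * (K : ℝ)) := by
  obtain ⟨τ, h1, h2⟩ := hS.exists_maximizer hT
  have hK := tendsto_two_mul_add_one_atTop
  filter_upwards [hK.eventually h1, hK.eventually (h2 (1 / 4) (by norm_num)),
    eventually_ge_atTop 6] with K ⟨hτ1, hτq, _, hL⟩ hτ hK6 x p hp hx
  set u := τ (2 * (K : ℝ) + 1) with hu
  have hu0 : 0 < u := by linarith
  have hK0 : (0 : ℝ) < K := by exact_mod_cast (by omega : 0 < K)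
  have hM := posDef_kernelMatrix hG hGS hS hp
  have hne : ∀ k, (x : ℝ) ≠ p k := fun k h => hx k (Subtype.ext h)
  have hP : 0 < ∏ k, |(x : ℝ) - p k| ^ 2 :=
    Finset.prod_pos fun k _ => pow_pos (abs_pos.2 (sub_ne_zero.2 (hne k))) 2
  rw [exp_rateF (by omega) hu0 hL]
  set P := ∏ k, |(x : ℝ) - p k| ^ 2 with hPdef
  constructor
  · rw [le_div_iff₀ (by positivity), hG.gaussianCondVariance_eq x p hM]
    have hdist : ∀ k, |(x : ℝ) - p k| ≤ 2 := fun k => by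
      have h1 := x.2
      have h2 := (p k).2
      rw [abs_le]
      constructor <;> linarith [h1.1, h1.2, h2.1, h2.2]
    -- with this step `a` the interval of radius `(K + 1) * a` ends at the peak `u`
    have h := le_residualEnergy hG hGS hS x (fun k => (p k : ℝ))
      ((kernelMatrix (stationaryKernel G) p)⁻¹.mulVec (kernelVector (stationaryKernel G) x p))
      hdist (a := u / (K + 1)) (by positivity) (by
        rw [div_le_iff₀ (by positivity)]; linarith)
    rw [mul_div_cancel₀ _ (by positivity)] at h
    refine le_trans ?_ h
    have hnum := exp_neg_mul_pow_succ_le hK6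
    rw [div_pow, ← hPdef]
    have e1 : Real.exp (-(K : ℝ)) * (u ^ (2 * K + 1) * Real.exp (-S u) / (K : ℝ) ^ (2 * K + 1) * P)
        = (Real.exp (-(K : ℝ)) * ((K : ℝ) + 1) ^ (2 * K + 1)) * (u ^ (2 * K + 1) * Real.exp (-S u)
          / ((K : ℝ) ^ (2 * K + 1) * ((K : ℝ) + 1) ^ (2 * K + 1)) * P) := by
      field_simp
    have e2 : Real.exp (-S u) *
        (2 * (u ^ (2 * K + 1) / ((K : ℝ) + 1) ^ (2 * K + 1)) * (25 / 36) ^ K * P)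
        = (2 * (25 / 36) ^ K * (K : ℝ) ^ (2 * K + 1)) * (u ^ (2 * K + 1) * Real.exp (-S u)
          / ((K : ℝ) ^ (2 * K + 1) * ((K : ℝ) + 1) ^ (2 * K + 1)) * P) := by
      field_simp
    rw [e1, e2]
    exact mul_le_mul_of_nonneg_right hnum (by positivity)
  · rw [div_le_iff₀ (by positivity)]
    -- the interpolation coefficients are a competitor in the minimum
    obtain ⟨c, hc⟩ := exists_norm_cexp_sub_le (x : ℝ) (fun k => (p k : ℝ))
      (fun i j h => hp (Subtype.ext h)) hne
    have hd : deriv S u = (2 * K + 1) / u := by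
      rw [eq_div_iff hu0.ne', mul_comm]; exact hτq
    have h := (hG.gaussianCondVariance_le x p hM c).trans
      (residualEnergy_le hG hGS hS (x : ℝ) (fun k => (p k : ℝ)) c
        (A := (∏ k, |(x : ℝ) - p k|) / K.factorial) (fun t => by
          refine (hc t).trans (le_of_eq ?_); ring) hu0 (by rw [hd]; positivity))
    refine h.trans ?_
    rw [hτq, hd, div_pow (∏ k, |(x : ℝ) - p k|), ← Finset.prod_pow, ← hPdef, div_pow _ u,
      sub_eq_add_neg, Real.exp_add]
    have hnum := two_mul_exp_mul_factorial_div_le (K := K) (by omega)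
    have e1 : P / (K.factorial : ℝ) ^ 2 * (Real.exp (2 * K + 1) * Real.exp (-S u) *
        (2 * ((2 * K).factorial / ((2 * K + 1) ^ (2 * K + 1) / u ^ (2 * K + 1)))))
        = (2 * Real.exp (2 * K + 1) * (2 * K).factorial * (K : ℝ) ^ (2 * K + 1)) *
          (P * u ^ (2 * K + 1) * Real.exp (-S u) / ((K.factorial : ℝ) ^ 2 *
            (2 * K + 1) ^ (2 * K + 1) * (K : ℝ) ^ (2 * K + 1))) := by
      field_simp
    have e2 : Real.exp (2 * K) * (u ^ (2 * K + 1) * Real.exp (-S u) / (K : ℝ) ^ (2 * K + 1) * P)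
        = (Real.exp (2 * K) * (K.factorial : ℝ) ^ 2 * (2 * K + 1) ^ (2 * K + 1)) *
          (P * u ^ (2 * K + 1) * Real.exp (-S u) / ((K.factorial : ℝ) ^ 2 *
            (2 * K + 1) ^ (2 * K + 1) * (K : ℝ) ^ (2 * K + 1))) := by
      field_simp
    rw [e1, e2]
    exact mul_le_mul_of_nonneg_right hnum (by positivity)

theorem theorem2 (Ghat G S T : ℝ → ℝ)
    (hG : IsSpectralDensity Ghat G)
    (hGS : ∀ t : ℝ, t ≠ 0 → Ghat t = Real.exp (-S |t|))
    (hGT : ∀ t : ℝ, t ≠ 0 → Ghat t = Real.exp (-T (Real.log |t|)))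
    (hS : ContDiffOn ℝ 2 S (Set.Ioi 0))
    (hT : ContDiff ℝ 2 T)
    (hS1 : ∀ t : ℝ, 0 < t → 0 ≤ deriv S t)
    (hS2 : ∀ t : ℝ, 0 < t → 0 ≤ deriv (deriv S) t)
    (hSlim : Tendsto (deriv S) atTop atTop) :
    -- the maximum that defines the Legendre transform exists for all large arguments
    (∀ᶠ q : ℝ in atTop,
      IsGreatest (Set.range fun s : ℝ => q * s - T s) (legendreTransform T q)) ∧
    -- the two-sided bound, uniformly over all sets of `K + 1` distinct points
    (∀ᶠ K : ℕ in atTop, ∀ (x : Set.Icc (-1 : ℝ) 1) (p : Fin K → Set.Icc (-1 : ℝ) 1),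
      Function.Injective p → (∀ k, x ≠ p k) →
      Real.exp (-(K : ℝ)) ≤
          gaussianCondVariance (stationaryKernel G) x p /
            (Real.exp (rateF T K) * ∏ k, |(x : ℝ) - (p k : ℝ)| ^ 2) ∧
        gaussianCondVariance (stationaryKernel G) x p /
            (Real.exp (rateF T K) * ∏ k, |(x : ℝ) - (p k : ℝ)| ^ 2) ≤
          Real.exp (2 * (K : ℝ))) ∧
    -- for distinct points the Gram matrix is invertible, and the quantity bounded above is the
    -- conditional variance of every centered Gaussian process with covariance `G`
    (∀ (K : ℕ) (x : Set.Icc (-1 : ℝ) 1) (p : Fin K → Set.Icc (-1 : ℝ) 1),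
      Function.Injective p →
      (kernelMatrix (stationaryKernel G) p).PosDef ∧
      ∀ (Ω : Type*) [MeasurableSpace Ω] (P : Measure Ω) [IsProbabilityMeasure P]
        (ξ : Set.Icc (-1 : ℝ) 1 → Ω → ℝ), IsCenteredGaussian P ξ (stationaryKernel G) →
        condVar (MeasurableSpace.comap (fun ω k => ξ (p k) ω) MeasurableSpace.pi) (ξ x) P
          =ᵐ[P] fun _ => gaussianCondVariance (stationaryKernel G) x p) ∧
    -- `F` is eventually decreasing, and `F K / K → -∞`
    (∃ K₀ : ℕ, StrictAntiOn (fun K : ℕ => rateF T K) (Set.Ici K₀)) ∧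
    Tendsto (fun K : ℕ => rateF T K / K) atTop atBot := by
  have hE : IsConvexExponent S := .of_contDiffOn hS hS1 hS2 hSlim
  have hTS : ∀ s, T s = S (Real.exp s) := fun s => by
    have h := (hGT _ (Real.exp_pos s).ne').symm.trans (hGS _ (Real.exp_pos s).ne')
    rwa [abs_of_pos (Real.exp_pos s), Real.log_exp, Real.exp_eq_exp, neg_inj] at h
  refine ⟨?_, eventually_condVariance_bounds hG hGS hE hTS, fun K x p hp => ?_,
    hE.exists_strictAntiOn_rateF hTS, hE.tendsto_rateF_div hTS⟩
  · obtain ⟨τ, h, -⟩ := hE.exists_maximizer hTS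
    filter_upwards [h] with q hq
    rw [hq.2.2.2]
    exact hq.2.2.1
  · have hM := posDef_kernelMatrix hG hGS hE hp
    refine ⟨hM, fun Ω _ P _ ξ hξ => hξ.condVar_ae_eq (fun y z => ?_) x p
      ((Matrix.isUnit_iff_isUnit_det _).1 hM.isUnit)⟩
    rw [stationaryKernel, stationaryKernel, ← hG.even, neg_sub]
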